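/- Let $m\ge 1$, $n\ge 0$, $q\ge 0$ be integers, and let the symmetric group $S_n$ act on $\mathbb R^n$ by $(\sigma\cdot x)_i=x_{\sigma^{-1}(i)}$ and on $(\mathbb R^n)^m$ by $\sigma\cdot(x_1,\dots,x_m)=(\sigma\cdot x_1,\dots,\sigma\cdot x_m)$. Let $K\subset\mathbb R^n$ be a compact convex set with nonempty interior that is stable under $S_n$. Let $\mathcal H_K^{\mathrm{inv}}(n,mn,q)$ be the set of restrictions to $K$ of all maps $f_2\circ\mathrm{ReLU}\circ f_1$, where $f_1:\mathbb R^n\to(\mathbb R^n)^m$ is affine and permutation equivariant ($f_1(\sigma\cdot x)=\sigma\cdot f_1(x)$), $f_2:(\mathbb R^n)^m\to\mathbb R^{q}$ is affine and permutation invariant ($f_2(\sigma\cdot X)=f_2(X)$), and ReLU acts componentwise. For $f:K\to\mathbb R^q$, a *region* is a nonempty connected open subset of $\mathbb R^n$ contained in $K$, and a *linear region* of $f$ is a region $D$ such that $f|_D$ is (the restriction of) an affine map and $f$ is not affine on any region strictly containing $D$. Let $\mathcal F(f)$ be the set of pairs $(f|_D,D)$, $D$ a linear region of $f$. Write $(f|_D,D)\sim(f|_{D'},D')$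 if there is a Euclidean transformation $\phi(x)=Ax+b$ of $\mathbb R^n$ ($A$ orthogonal) with $\phi(D)=D'$ and $f|_D=f|_{D'}\circ\phi|_D$. Put $c^\sim(f)=|\mathcal F(f)/{\sim}|$, and let $c^\sim(\mathcal H)$ be the maximum of $c^\sim(f)$ over $f\in\mathcal H$ (with $c^\sim(\mathcal H)=\infty$ if these numbers are unbounded). Let $H(p)=-p\log_2p-(1-p)\log_2(1-p)$ for $0<p<1$, $H(0)=H(1)=0$, put $\alpha=2^{mH(1/m)}$, and for real $\gamma\ge0$ let $\gamma!=\prod_{k\in\mathbb Z,\;0\le k<\gamma}(\gamma-k)$. Then $$c^\sim\bigl(\mathcal H_K^{\mathrm{inv}}(n,mn,q)\bigr)\;\le\;\frac{(n+\alpha)!}{\alpha!\,n!}.$$ Moreover, for fixed $m$ the right-hand side is polynomially bounded in $n$: there is a real polynomial $p$ of degree $\lfloor\alpha\rfloor+1$, depending only on $m$, with $\frac{(n+\alpha)!}{\alpha!\,n!}\le p(n)$ for all $n\ge0$. -/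

import Mathlib

namespace DeepSets

/-- `ℝⁿ` with its Euclidean norm. -/
abbrev Vec (n : ℕ) : Type := EuclideanSpace ℝ (Fin n)

/-! ### Linear regions and the measure of complexity -/

section Complexity

variable {n q : ℕ} {K : Set (Vec n)}

/-- `f : K → ℝ^q` is linear (that is, affine) on `D`. -/
def IsLinearOn (f : K → Vec q) (D : Set (Vec n)) : Prop :=
  ∃ g : Vec n →ᵃ[ℝ] Vec q, ∀ x : K, (x : Vec n) ∈ D → f x = g x

/-- A connected region in `K`: a nonempty connected open subset of `ℝⁿ` contained in `K`. -/
def IsRegion (K D : Set (Vec n)) : Prop :=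
  IsOpen D ∧ IsConnected D ∧ D ⊆ K

/-- A linear region of `f`: a connected region on which `f` is linear, and such that `f` is not
linear on any strictly larger connected region. -/
def IsLinearRegion (f : K → Vec q) (D : Set (Vec n)) : Prop :=
  IsRegion K D ∧ IsLinearOn f D ∧ ∀ D' : Set (Vec n), IsRegion K D' → D ⊂ D' → ¬ IsLinearOn f D'

/-- The set of linear functions of `f`. Its elements are the pairs `(f|_D, D)` for the linear
regions `D`; since `f|_D` is determined by `D`, such a pair is recorded by `D`. -/
def LinearFunctions (f : K → Vec q) : Type :=
  {D : Set (Vec n) // IsLinearRegion f D}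

/-- `(f|_D, D)` and `(f|_D', D')` are equivalent if some Euclidean transformation `φ` of `ℝⁿ`
satisfies `φ(D) = D'` and `f|_D = f|_D' ∘ φ|_D`. -/
def Equivalent (f : K → Vec q) (D D' : LinearFunctions f) : Prop :=
  ∃ φ : Vec n ≃ᵃⁱ[ℝ] Vec n, φ '' D.1 = D'.1 ∧
    ∀ x y : K, (x : Vec n) ∈ D.1 → (y : Vec n) = φ x → f x = f y

theorem equivalent_equivalence (f : K → Vec q) : Equivalence (Equivalent f) where
  refl D := ⟨AffineIsometryEquiv.refl ℝ (Vec n), by simp, by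
    intro x y _ hxy
    have : y = x := Subtype.ext (by simpa using hxy)
    rw [this]⟩
  symm := by
    rintro D D' ⟨φ, h, hf⟩
    refine ⟨φ.symm, ?_, ?_⟩
    · rw [← h, Set.image_image]
      simp
    · intro x y hx hxy
      have hx' : (x : Vec n) = φ y := by rw [hxy]; simp
      have hy : (y : Vec n) ∈ D.1 := by
        rw [← h] at hx
        obtain ⟨z, hz, hzx⟩ := hx
        rw [hxy, ← hzx]
        simpa using hz
      exact (hf y x hy hx').symm
  trans := by
    rintro D D' D'' ⟨φ, h, hf⟩ ⟨ψ, h', hf'⟩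
    refine ⟨φ.trans ψ, ?_, ?_⟩
    · rw [← h', ← h, Set.image_image]
      simp
    · intro x y hx hxy
      have hφ : φ x ∈ D'.1 := h ▸ Set.mem_image_of_mem φ hx
      have h1 := hf x ⟨φ x, D'.2.1.2.2 hφ⟩ hx rfl
      exact h1.trans (hf' ⟨φ x, D'.2.1.2.2 hφ⟩ y hφ (by simpa using hxy))

/-- The equivalence relation on the linear functions of `f`. -/
def linearSetoid (f : K → Vec q) : Setoid (LinearFunctions f) :=
  ⟨Equivalent f, equivalent_equivalence f⟩

/-- The measure of complexity of `f`: the number of equivalence classes of its linear functions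
(`⊤` if there are infinitely many). -/
noncomputable def complexity (f : K → Vec q) : ℕ∞ :=
  ENat.card (Quotient (linearSetoid f))

/-- The measure of complexity of a set `H` of functions: the maximum of the complexities of its
elements (`⊤` if they are unbounded; a finite supremum in `ℕ∞` over a nonempty set is attained). -/
noncomputable def classComplexity (H : Set (K → Vec q)) : ℕ∞ :=
  ⨆ f ∈ H, complexity f

end Complexity

/-! ### Permutation-invariant shallow ReLU networks -/

/-- The action of `σ ∈ S_n` on `ℝⁿ`: `(σ • x)_i = x_{σ⁻¹(i)}`. -/
def permVec {n : ℕ} (σ : Equiv.Perm (Fin n)) (x : Vec n) : Vec n :=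
  WithLp.toLp 2 fun i => x (σ⁻¹ i)

/-- The action of `σ ∈ S_n` on `(ℝⁿ)^m`, on each of the `m` vectors. -/
def permTuple {n m : ℕ} (σ : Equiv.Perm (Fin n)) (X : Fin m → Vec n) : Fin m → Vec n :=
  fun i => permVec σ (X i)

/-- `K` is stable by the permutation action. -/
def IsPermStable {n : ℕ} (K : Set (Vec n)) : Prop :=
  ∀ σ : Equiv.Perm (Fin n), ∀ x ∈ K, permVec σ x ∈ K

/-- ReLU on `(ℝⁿ)^m`, componentwise. -/
noncomputable def relu {n m : ℕ} (X : Fin m → Vec n) : Fin m → Vec n :=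
  fun i => WithLp.toLp 2 fun j => max 0 (X i j)

/-- The set of the restrictions to `K` of the networks `f₂ ∘ ReLU ∘ f₁`, with
`f₁ : ℝⁿ → (ℝⁿ)^m` affine and permutation equivariant, and `f₂ : (ℝⁿ)^m → ℝ^q` affine and
permutation invariant. -/
def invNetworks {n : ℕ} (K : Set (Vec n)) (m q : ℕ) : Set (K → Vec q) :=
  {F | ∃ (f₁ : Vec n →ᵃ[ℝ] (Fin m → Vec n)) (f₂ : (Fin m → Vec n) →ᵃ[ℝ] Vec q),
    (∀ (σ : Equiv.Perm (Fin n)) (x : Vec n), f₁ (permVec σ x) = permTuple σ (f₁ x)) ∧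
    (∀ (σ : Equiv.Perm (Fin n)) (X : Fin m → Vec n), f₂ (permTuple σ X) = f₂ X) ∧
    ∀ x : K, F x = f₂ (relu (f₁ x))}

/-! ### The bound -/

/-- The binary entropy function (in bits); its values at `0` and `1` are `0`. -/
noncomputable def binaryEntropy (p : ℝ) : ℝ :=
  -p * Real.logb 2 p - (1 - p) * Real.logb 2 (1 - p)

/-- `α = 2^{m H(1/m)}`. -/
noncomputable def alpha (m : ℕ) : ℝ :=
  (2 : ℝ) ^ ((m : ℝ) * binaryEntropy (1 / (m : ℝ)))

/-- The generalized factorial `γ! = ∏_{0 ≤ k < γ} (γ - k)`, `k` an integer; for natural `k`,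
`k < γ` is equivalent to `k < ⌈γ⌉₊`. -/
noncomputable def genFactorial (γ : ℝ) : ℝ :=
  ∏ k ∈ Finset.range ⌈γ⌉₊, (γ - (k : ℝ))

/-- `(n + α)! / (α! n!)` with `α = 2^{m H(1/m)}`. -/
noncomputable def orbitBound (m n : ℕ) : ℝ :=
  genFactorial ((n : ℝ) + alpha m) / (genFactorial (alpha m) * (n.factorial : ℝ))

end DeepSets

namespace DeepSets

/-! On an open cell of the arrangement of the `mn` forms of `f₁`, the network is affine. Every
linear region meets a cell, and regions meeting cells in the same `S_n`-orbit are images of each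
other under a permutation (`image_permVec_subset`), so `complexity_le_card_orbits` bounds the
classes by orbits of cells. Burnside counts these orbits by the cells stable under each `g`.
Averaging gives such a cell a `g`-fixed point, so it is seen in the fixed space of `g`. If `g` has
`c` cycles, this space has dimension `c` and only `mc` forms matter there. Sauer–Shelah gives at
most `∑_{k ≤ c} (mc choose k)` cells, which is at most `(α + 1)^c`. The cycle enumerator
(`sum_pow_numCycles`) turns the Burnside sum into `(α + 1)(α + 2)⋯(α + n)`; division by `n!` gives
the bound. -/

/-! ### Counting cells of an affine arrangement. -/

open Finset in
/-- If `N` affine forms on a space of dimension `d` realise every sign pattern, then `N ≤ d`. -/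
theorem card_le_finrank_of_shatter {ι V : Type*} [DecidableEq ι] [AddCommGroup V] [Module ℝ V]
    [FiniteDimensional ℝ V] (h : ι → V →ᵃ[ℝ] ℝ) (T : Finset ι)
    (hT : ∀ A ⊆ T, ∃ x, ∀ i ∈ T, (i ∈ A → 0 < h i x) ∧ (i ∉ A → h i x < 0)) :
    #T ≤ Module.finrank ℝ V := by
  by_contra! hcard
  -- A relation among the linear parts makes the same combination of the forms constant.
  have hdep : ¬ LinearIndependent ℝ fun i : T => (h i).linear := by
    intro hli
    have := hli.fintype_card_le_finrank
    rw [Fintype.card_coe, Subspace.dual_finrank_eq] at this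
    omega
  obtain ⟨c, hc, i₀, hi₀⟩ := Fintype.not_linearIndependent_iff.1 hdep
  have hconst : ∀ x, ∑ i : T, c i * h i x = ∑ i : T, c i * h i 0 := by
    intro x
    rw [← sub_eq_zero, ← Finset.sum_sub_distrib]
    have := LinearMap.congr_fun hc x
    simp only [LinearMap.sum_apply, LinearMap.smul_apply, smul_eq_mul, LinearMap.zero_apply] at this
    rw [← this]
    refine Finset.sum_congr rfl fun i _ => ?_
    rw [← mul_sub, ← vsub_eq_sub (h i x), ← AffineMap.linearMap_vsub]
    simp
  -- At a point where each `h i` has the sign of `s * c i`, the constant has the sign of `s`; `s =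
  -- 1` and `s = -1` contradict each other.
  have key : ∀ s : ℝ, s ≠ 0 → 0 < s * ∑ i : T, c i * h i 0 := by
    intro s hs
    obtain ⟨x, hx⟩ := hT (T.attach.filter (fun i => 0 < s * c i) |>.map
      (Function.Embedding.subtype _)) (by
        intro i hi
        simp only [Finset.mem_map, Function.Embedding.coe_subtype] at hi
        obtain ⟨j, _, rfl⟩ := hi
        exact j.2)
    rw [← hconst x, Finset.mul_sum]
    have hterm : ∀ i : T, c i ≠ 0 → 0 < s * (c i * h i x) := by
      intro i hci
      rw [← mul_assoc]
      rcases (mul_ne_zero hs hci).lt_or_gt with hlt | hgt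
      · refine mul_pos_of_neg_of_neg hlt ((hx i i.2).2 ?_)
        simpa using hlt.le
      · refine mul_pos hgt ((hx i i.2).1 ?_)
        simpa using hgt
    refine Finset.sum_pos' (fun i _ => ?_) ⟨i₀, Finset.mem_univ _, hterm i₀ hi₀⟩
    by_cases hci : c i = 0
    · simp [hci]
    · exact (hterm i hci).le
  have h1 := key 1 one_ne_zero
  have h2 := key (-1) (by norm_num)
  linarith

open Finset in
/-- The number of open cells of an arrangement of affine hyperplanes, via Sauer–Shelah. -/
theorem card_sign_patterns_le {ι V : Type*} [Fintype ι] [DecidableEq ι] [AddCommGroup V]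
    [Module ℝ V] [FiniteDimensional ℝ V] (h : ι → V →ᵃ[ℝ] ℝ) (𝒜 : Finset (Finset ι))
    (h𝒜 : ∀ A ∈ 𝒜, ∃ x, ∀ i, (i ∈ A → 0 < h i x) ∧ (i ∉ A → h i x < 0)) :
    #𝒜 ≤ ∑ k ∈ range (Module.finrank ℝ V + 1), (Fintype.card ι).choose k := by
  refine (card_le_card_shatterer 𝒜).trans (card_shatterer_le_sum_vcDim.trans ?_)
  refine Finset.sum_le_sum_of_subset fun k hk => ?_
  rw [mem_Iic] at hk
  rw [mem_range, Nat.lt_succ_iff]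
  refine hk.trans (Finset.sup_le fun T hT => ?_)
  rw [mem_shatterer] at hT
  refine card_le_finrank_of_shatter h T fun A hA => ?_
  obtain ⟨U, hU, hTU⟩ := hT hA
  obtain ⟨x, hx⟩ := h𝒜 U hU
  refine ⟨x, fun i hi => ⟨fun hiA => (hx i).1 ?_, fun hiA => (hx i).2 fun hiU => hiA ?_⟩⟩
  · rw [← hTU] at hiA; exact (mem_inter.1 hiA).2
  · rw [← hTU]; exact mem_inter.2 ⟨hi, hiU⟩

/-! ### Burnside's lemma and the cycle enumerator of `S_n`. -/

/-- The number of cycles of `g`, fixed points included. -/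
noncomputable def numCycles {n : ℕ} (g : Equiv.Perm (Fin n)) : ℕ :=
  Nat.card (Quotient (Equiv.Perm.SameCycle.setoid g))

theorem eq_of_sameCycle {α β : Type*} {g : Equiv.Perm α} {F : α → β} (hF : ∀ a, F (g a) = F a)
    {a b : α} (h : g.SameCycle a b) : F a = F b := by
  obtain ⟨k, rfl⟩ := h
  have hinv : ∀ a, F (g⁻¹ a) = F a := fun a => by rw [← hF (g⁻¹ a)]; simp
  induction k using Int.induction_on with
  | zero => simp
  | succ k ih => rw [add_comm, zpow_add, Equiv.Perm.mul_apply, zpow_one, hF, ← ih]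
  | pred k ih =>
    rw [sub_eq_add_neg, add_comm, zpow_add, Equiv.Perm.mul_apply, zpow_neg_one, hinv, ← ih]

/-- Functions constant on the cycles of `g` are the functions on the set of cycles. -/
def invariantFunEquiv {α β : Type*} (g : Equiv.Perm α) :
    {F : α → β // ∀ a, F (g a) = F a} ≃ (Quotient (Equiv.Perm.SameCycle.setoid g) → β) where
  toFun F := Quotient.lift F.1 fun _ _ h => eq_of_sameCycle F.2 h
  invFun G := ⟨fun a => G ⟦a⟧, fun a => congrArg G (Quotient.sound
    (show g.SameCycle (g a) a from (Equiv.Perm.sameCycle_apply_left).2 (.refl _ _)))⟩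
  left_inv F := rfl
  right_inv G := by
    funext o
    induction o using Quotient.inductionOn
    rfl

attribute [local instance] arrowAction

theorem perm_smul_apply {n : ℕ} {β : Type*} (g : Equiv.Perm (Fin n)) (F : Fin n → β) (a : Fin n) :
    (g • F) a = F (g⁻¹ a) := rfl

theorem perm_smul_eq_iff {n : ℕ} {β : Type*} (g : Equiv.Perm (Fin n)) (F : Fin n → β) :
    g • F = F ↔ ∀ a, F (g a) = F a := by
  constructor
  · intro h a
    rw [← congrFun h (g a), perm_smul_apply]; simp
  · intro h
    funext a
    rw [perm_smul_apply, ← h (g⁻¹ a)]; simp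

theorem card_fixedBy_fun {n : ℕ} (k : ℕ) (g : Equiv.Perm (Fin n)) :
    Nat.card (MulAction.fixedBy (Fin n → Fin k) g) = k ^ numCycles g := by
  classical
  have e : MulAction.fixedBy (Fin n → Fin k) g ≃ {F : Fin n → Fin k // ∀ a, F (g a) = F a} :=
    Equiv.subtypeEquivRight fun F => perm_smul_eq_iff g F
  rw [Nat.card_congr (e.trans (invariantFunEquiv g)), Nat.card_fun]
  simp [numCycles]

theorem sum_natCard_fixedBy (n : ℕ) (X : Type*) [Finite X] [MulAction (Equiv.Perm (Fin n)) X] :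
    ∑ g : Equiv.Perm (Fin n), Nat.card (MulAction.fixedBy X g) =
      Nat.card (Quotient (MulAction.orbitRel (Equiv.Perm (Fin n)) X)) * n.factorial := by
  classical
  have := Fintype.ofFinite X
  have := MulAction.sum_card_fixedBy_eq_card_orbits_mul_card_group (Equiv.Perm (Fin n)) X
  simp only [Nat.card_eq_fintype_card]
  rw [this, Fintype.card_perm, Fintype.card_fin]

/-- Equal multiplicities give fibres of equal size, which are matched one by one. -/
theorem exists_perm_of_map_eq {α β : Type*} [Fintype α] {F G : α → β}
    (h : (Finset.univ.val.map F) = Finset.univ.val.map G) : ∃ g : Equiv.Perm α, F ∘ g = G := by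
  classical
  have hc : ∀ b, Nonempty ({a // G a = b} ≃ {a // F a = b}) := by
    intro b
    have := congrArg (Multiset.count b) h
    rw [Multiset.count_map, Multiset.count_map] at this
    refine ⟨Fintype.equivOfCardEq ?_⟩
    rw [Fintype.card_subtype, Fintype.card_subtype, Finset.card_def, Finset.card_def]
    simpa [eq_comm] using this.symm
  let e := fun b => (hc b).some
  exact ⟨Equiv.ofFiberEquiv e, funext fun a => Equiv.ofFiberEquiv_map e a⟩

/-- The orbits of `S_n` on `Fin n → Fin k` are the multisets of size `n` in `Fin k`. -/
theorem card_orbits_fun (n k : ℕ) :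
    Nat.card (Quotient (MulAction.orbitRel (Equiv.Perm (Fin n)) (Fin n → Fin k))) =
      k.multichoose n := by
  have hk := Sym.card_sym_eq_multichoose (Fin k) n
  rw [Fintype.card_fin] at hk
  rw [← hk, ← Nat.card_eq_fintype_card]
  let φ : (Fin n → Fin k) → Sym (Fin k) n := fun F => ⟨Finset.univ.val.map F, by simp⟩
  have hφ : ∀ F G : Fin n → Fin k,
      MulAction.orbitRel (Equiv.Perm (Fin n)) (Fin n → Fin k) F G → φ F = φ G := by
    rintro F G ⟨g, rfl⟩
    refine Subtype.ext ?_
    change Finset.univ.val.map (G ∘ (g⁻¹ : Equiv.Perm (Fin n))) = Finset.univ.val.map G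
    rw [← Multiset.map_map]
    congr 1
    have := congrArg Finset.val (Finset.map_univ_equiv (g⁻¹ : Equiv.Perm (Fin n)))
    rwa [Finset.map_val] at this
  refine Nat.card_congr (Equiv.ofBijective (Quotient.lift φ hφ) ⟨?_, ?_⟩)
  · intro a b
    induction a, b using Quotient.inductionOn₂ with
    | _ F G =>
      intro h
      have hFG : Finset.univ.val.map F = Finset.univ.val.map G := congrArg Subtype.val h
      obtain ⟨g, hg⟩ := exists_perm_of_map_eq hFG
      refine Quotient.sound (s := MulAction.orbitRel _ _) ⟨g, ?_⟩
      funext a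
      change G (g⁻¹ a) = F a
      rw [← hg]
      simp
  · rintro ⟨s, hs⟩
    induction s using Quotient.inductionOn with
    | _ l =>
      have hl : l.length = n := hs
      subst hl
      exact ⟨Quotient.mk _ l.get, Subtype.ext (by
        change Finset.univ.val.map l.get = (l : Multiset (Fin k))
        rw [Fin.univ_val_map, List.ofFn_get])⟩

/-- The cycle enumerator of `S_n` is the rising factorial. -/
theorem sum_pow_numCycles (n : ℕ) (x : ℝ) :
    ∑ g : Equiv.Perm (Fin n), x ^ numCycles g = (ascPochhammer ℝ n).eval x := by
  -- It suffices to compare values at natural `k`, where both sides are `n!` times the number of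
  -- orbits of `k`-colourings.
  have hpoly : ∑ g : Equiv.Perm (Fin n), (Polynomial.X : Polynomial ℝ) ^ numCycles g =
      ascPochhammer ℝ n := by
    refine Polynomial.eq_of_infinite_eval_eq _ _ ((Set.infinite_range_of_injective
      (Nat.cast_injective (R := ℝ))).mono ?_)
    rintro _ ⟨k, rfl⟩
    have h := sum_natCard_fixedBy n (Fin n → Fin k)
    simp only [card_fixedBy_fun, card_orbits_fun] at h
    have h2 := Ring.factorial_nsmul_multichoose_eq_ascPochhammer k n
    simp only [Set.mem_ofPred_eq, Polynomial.eval_finsetSum, Polynomial.eval_pow,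
      Polynomial.eval_X]
    rw [← Nat.cast_ascFactorial, ← ascPochhammer_nat_eq_ascFactorial]
    have h3 : k.multichoose n * n.factorial = (ascPochhammer ℕ n).eval k := by
      rw [← Polynomial.eval_eq_smeval] at h2
      rw [← h2, smul_eq_mul, mul_comm]
      rfl
    rw [← h3, ← h]
    push_cast
    rfl
  rw [← hpoly]
  simp [Polynomial.eval_finsetSum]

/-! ### The entropy bound on partial binomial sums. -/

theorem alpha_eq (m : ℕ) (hm : 2 ≤ m) :
    alpha m = (m : ℝ) * ((m : ℝ) / (m - 1)) ^ (m - 1) := by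
  have h1 : (1 : ℝ) < m := by exact_mod_cast hm
  have h0 : (0 : ℝ) < m := by linarith
  have h2 : (0 : ℝ) < m - 1 := by linarith
  have e : (1 : ℝ) - 1 / m = (m - 1) / m := by field_simp
  have key : (m : ℝ) * binaryEntropy (1 / m) =
      Real.logb 2 ((m : ℝ) * ((m : ℝ) / (m - 1)) ^ (m - 1)) := by
    rw [Real.logb_mul h0.ne' (by positivity), Real.logb_pow, Nat.cast_sub (by omega),
      Nat.cast_one, binaryEntropy, e, one_div, Real.logb_inv,
      Real.logb_div h2.ne' h0.ne', Real.logb_div h0.ne' h2.ne']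
    field_simp
    ring
  rw [alpha, key, Real.rpow_logb (by norm_num) (by norm_num) (by positivity)]

theorem alpha_one : alpha 1 = 1 := by
  simp [alpha, binaryEntropy]

theorem alpha_pos (m : ℕ) : 0 < alpha m := by
  unfold alpha; positivity

/-- In the binomial law with `mc` trials and `p = 1/m`, an outcome with `k ≤ c` successes has
probability at least `p^c r^(mc-c) = α^(-c)`, because `p ≤ r`. The total probability is `1`. -/
theorem sum_choose_le_alpha_pow {m : ℕ} (hm : 2 ≤ m) (c : ℕ) :
    (∑ k ∈ Finset.range (c + 1), ((m * c).choose k : ℝ)) ≤ alpha m ^ c := by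
  have h1 : (1 : ℝ) < m := by exact_mod_cast hm
  have h2' : (2 : ℝ) ≤ m := by exact_mod_cast hm
  have h0 : (0 : ℝ) < m := by linarith
  have h2 : (0 : ℝ) < m - 1 := by linarith
  set p : ℝ := 1 / m with hp
  set r : ℝ := (m - 1) / m with hr
  have hp0 : 0 < p := by positivity
  have hr0 : 0 < r := by positivity
  have hpr : p ≤ r := by
    rw [hp, hr]; gcongr; linarith
  have hsum : p + r = 1 := by rw [hp, hr]; field_simp; ring
  have hcm : c ≤ m * c := Nat.le_mul_of_pos_left c (by omega)
  have hα : alpha m ^ c * (p ^ c * r ^ (m * c - c)) = 1 := by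
    have : m * c - c = (m - 1) * c := by rw [Nat.sub_mul, one_mul]
    rw [this, pow_mul, ← mul_pow, ← mul_pow, alpha_eq m hm, hp, hr, mul_assoc,
      mul_left_comm _ (1 / (m : ℝ)), ← mul_pow]
    have : (m : ℝ) / (m - 1) * ((m - 1) / m) = 1 := by field_simp
    rw [this, one_pow, mul_one, mul_one_div_cancel h0.ne', one_pow]
  have hw : 0 < p ^ c * r ^ (m * c - c) := by positivity
  have hmain : (∑ k ∈ Finset.range (c + 1), ((m * c).choose k : ℝ)) *
      (p ^ c * r ^ (m * c - c)) ≤ 1 := by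
    calc _ = ∑ k ∈ Finset.range (c + 1), p ^ c * r ^ (m * c - c) * ((m * c).choose k : ℝ) := by
          rw [Finset.sum_mul]; exact Finset.sum_congr rfl fun _ _ => mul_comm _ _
      _ ≤ ∑ k ∈ Finset.range (c + 1), p ^ k * r ^ (m * c - k) * ((m * c).choose k : ℝ) := by
          refine Finset.sum_le_sum fun k hk => ?_
          have hk : k ≤ c := by simpa [Nat.lt_succ_iff] using hk
          gcongr ?_ * _
          have e1 : p ^ c = p ^ k * p ^ (c - k) := by rw [← pow_add]; congr 1; omega
          have e2 : r ^ (m * c - k) = r ^ (c - k) * r ^ (m * c - c) := by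
            rw [← pow_add]; congr 1; omega
          rw [e1, e2, mul_assoc]
          gcongr
      _ ≤ ∑ k ∈ Finset.range (m * c + 1), p ^ k * r ^ (m * c - k) * ((m * c).choose k : ℝ) := by
          refine Finset.sum_le_sum_of_subset_of_nonneg
            (Finset.range_subset_range.2 (by omega)) fun _ _ _ => by positivity
      _ = 1 := by rw [← add_pow, hsum, one_pow]
  rw [← hα] at hmain
  exact le_of_mul_le_mul_right hmain hw

/-- For `m = 1` the sum is `2^c` while `α = 1`, so the extra `1` is needed there; for larger `m` it
is slack. -/
theorem sum_choose_le_alpha_add_one_pow {m : ℕ} (hm : 1 ≤ m) (c : ℕ) :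
    (∑ k ∈ Finset.range (c + 1), ((m * c).choose k : ℝ)) ≤ (alpha m + 1) ^ c := by
  rcases hm.eq_or_lt with rfl | hm
  · rw [alpha_one, one_mul]
    exact_mod_cast (Nat.sum_range_choose c).le
  · exact (sum_choose_le_alpha_pow hm c).trans
      (pow_le_pow_left₀ (alpha_pos m).le (by linarith) c)

/-! ### The bound as a rising factorial, and its polynomial growth. -/

theorem genFactorial_pos (γ : ℝ) : 0 < genFactorial γ :=
  Finset.prod_pos fun _ hk => sub_pos.2 (Nat.lt_ceil.1 (Finset.mem_range.1 hk))

theorem genFactorial_add_one {γ : ℝ} (h : 0 ≤ γ) :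
    genFactorial (γ + 1) = (γ + 1) * genFactorial γ := by
  rw [genFactorial, Nat.ceil_add_one h, Finset.prod_range_succ', mul_comm, genFactorial]
  congr 1
  · simp
  · exact Finset.prod_congr rfl fun k _ => by push_cast; ring

theorem genFactorial_natCast_add {γ : ℝ} (h : 0 ≤ γ) (n : ℕ) :
    genFactorial ((n : ℝ) + γ) = (ascPochhammer ℝ n).eval (γ + 1) * genFactorial γ := by
  induction n with
  | zero => simp
  | succ n ih =>
    have : ((n + 1 : ℕ) : ℝ) + γ = (n + γ) + 1 := by push_cast; ring
    rw [this, genFactorial_add_one (by positivity), ih, ascPochhammer_succ_eval]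
    ring

theorem orbitBound_eq (m n : ℕ) :
    orbitBound m n = (ascPochhammer ℝ n).eval (alpha m + 1) / n.factorial := by
  rw [orbitBound, genFactorial_natCast_add (alpha_pos m).le]
  have := (genFactorial_pos (alpha m)).ne'
  field_simp

theorem ascPochhammer_eval_mono (n : ℕ) {x y : ℝ} (hx : 0 < x) (hxy : x ≤ y) :
    (ascPochhammer ℝ n).eval x ≤ (ascPochhammer ℝ n).eval y := by
  induction n with
  | zero => simp
  | succ n ih =>
    rw [ascPochhammer_succ_eval, ascPochhammer_succ_eval]
    have := (ascPochhammer_pos n y (hx.trans_le hxy)).le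
    gcongr

/-- The bound is dominated by a polynomial in `n`, namely the binomial `(n + l).choose l` for
`l = ⌊α⌋ + 1`. -/
theorem exists_polynomial_bound (m : ℕ) :
    ∃ p : Polynomial ℝ, p.natDegree = ⌊alpha m⌋₊ + 1 ∧
      ∀ n : ℕ, orbitBound m n ≤ p.eval (n : ℝ) := by
  set l := ⌊alpha m⌋₊ + 1 with hl
  have hfac : (l.factorial : ℝ)⁻¹ ≠ 0 := by positivity
  refine ⟨Polynomial.C (l.factorial : ℝ)⁻¹ * (ascPochhammer ℝ l).comp (Polynomial.X + 1), ?_, ?_⟩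
  · rw [Polynomial.natDegree_C_mul hfac, Polynomial.natDegree_comp, ascPochhammer_natDegree]
    have : (Polynomial.X + 1 : Polynomial ℝ).natDegree = 1 := by
      rw [← Polynomial.C_1, Polynomial.natDegree_X_add_C]
    rw [this, mul_one]
  · intro n
    have hle : alpha m ≤ l := by rw [hl]; push_cast; exact (Nat.lt_floor_add_one _).le
    calc orbitBound m n ≤ (ascPochhammer ℝ n).eval ((l : ℝ) + 1) / n.factorial := by
          rw [orbitBound_eq]
          gcongr
          exact ascPochhammer_eval_mono n (by linarith [alpha_pos m]) (by linarith)
      _ = _ := by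
          have h1 : (ascPochhammer ℝ n).eval ((l : ℝ) + 1) = ((l + 1).ascFactorial n : ℝ) := by
            rw [Nat.cast_ascFactorial]; push_cast; rfl
          have h2 : (ascPochhammer ℝ l).eval ((n : ℝ) + 1) = ((n + 1).ascFactorial l : ℝ) := by
            rw [Nat.cast_ascFactorial]; push_cast; rfl
          -- Both sides are `(n + l)!`.
          have h3 : (l.factorial : ℝ) * ((l + 1).ascFactorial n : ℝ) =
              n.factorial * ((n + 1).ascFactorial l : ℝ) := by
            norm_cast
            rw [Nat.factorial_mul_ascFactorial, Nat.factorial_mul_ascFactorial, add_comm]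
          simp only [Polynomial.eval_mul, Polynomial.eval_C, Polynomial.eval_comp,
            Polynomial.eval_add, Polynomial.eval_X, Polynomial.eval_one]
          rw [h1, h2]
          field_simp
          linarith

/-! ### Gluing and maximality of linear regions. -/

section Regions

variable {n q : ℕ} {K : Set (Vec n)} {f : K → Vec q}

theorem affineMap_eq_of_eqOn_open {g g' : Vec n →ᵃ[ℝ] Vec q} {U : Set (Vec n)} (hU : IsOpen U)
    (hne : U.Nonempty) (h : Set.EqOn g g' U) : g = g' :=
  AffineMap.ext_on (hU.affineSpan_eq_top hne) h

theorem IsRegion.union {D D' : Set (Vec n)} (h : IsRegion K D) (h' : IsRegion K D')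
    (hne : (D ∩ D').Nonempty) : IsRegion K (D ∪ D') :=
  ⟨h.1.union h'.1, h.2.1.union hne h'.2.1, Set.union_subset h.2.2 h'.2.2⟩

/-- Affine maps that agree on the nonempty open overlap are equal. -/
theorem IsLinearOn.union {D D' : Set (Vec n)} (hD : IsRegion K D) (hD' : IsRegion K D')
    (h : IsLinearOn f D) (h' : IsLinearOn f D') (hne : (D ∩ D').Nonempty) :
    IsLinearOn f (D ∪ D') := by
  obtain ⟨g, hg⟩ := h
  obtain ⟨g', hg'⟩ := h'
  have hgg : g = g' := affineMap_eq_of_eqOn_open (hD.1.inter hD'.1) hne fun x hx => by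
    rw [← hg ⟨x, hD.2.2 hx.1⟩ hx.1, ← hg' ⟨x, hD.2.2 hx.1⟩ hx.2]
  subst hgg
  exact ⟨g, fun x hx => hx.elim (hg x) (hg' x)⟩

/-- A linear region contains every region that it meets and on which `f` is linear. -/
theorem IsLinearRegion.subset_of_meets {D D' : Set (Vec n)} (hD : IsLinearRegion f D)
    (hD' : IsRegion K D') (h' : IsLinearOn f D') (hne : (D ∩ D').Nonempty) : D' ⊆ D := by
  by_contra hnot
  refine hD.2.2 (D ∪ D') (hD.1.union hD' hne) ?_ (hD.2.1.union hD.1 hD' h' hne)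
  exact ⟨Set.subset_union_left, fun hsub => hnot (Set.subset_union_right.trans hsub)⟩

end Regions

/-! ### Permutations acting on the cells of an equivariant arrangement. -/

/-- The action of a permutation as a linear isometry. -/
noncomputable def permIsometry {n : ℕ} (σ : Equiv.Perm (Fin n)) : Vec n ≃ₗᵢ[ℝ] Vec n :=
  LinearIsometryEquiv.piLpCongrLeft 2 ℝ ℝ σ

theorem permIsometry_apply {n : ℕ} (σ : Equiv.Perm (Fin n)) (x : Vec n) :
    permIsometry σ x = permVec σ x := by
  ext i
  simp [permIsometry, permVec, LinearIsometryEquiv.piLpCongrLeft_apply, Equiv.piCongrLeft']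

@[simp]
theorem permVec_apply {n : ℕ} (σ : Equiv.Perm (Fin n)) (x : Vec n) (i : Fin n) :
    permVec σ x i = x (σ⁻¹ i) := rfl

@[simp]
theorem permVec_inv_permVec {n : ℕ} (σ : Equiv.Perm (Fin n)) (x : Vec n) :
    permVec σ⁻¹ (permVec σ x) = x := by
  ext i
  rw [permVec_apply, permVec_apply, inv_inv]
  exact congrArg x (σ.symm_apply_apply i)

@[simp]
theorem permVec_permVec_inv {n : ℕ} (σ : Equiv.Perm (Fin n)) (x : Vec n) :
    permVec σ (permVec σ⁻¹ x) = x := by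
  ext i
  rw [permVec_apply, permVec_apply, inv_inv]
  exact congrArg x (σ.apply_symm_apply i)

section Arrangement

variable {m n : ℕ}

/-- A family of affine forms on `ℝⁿ` permuted by `S_n`. -/
def IsEquivariant (h : Fin m → Fin n → Vec n →ᵃ[ℝ] ℝ) : Prop :=
  ∀ i j (σ : Equiv.Perm (Fin n)) x, h i j (permVec σ x) = h i (σ⁻¹ j) x

/-- The open cell of the arrangement of the forms `h` with the set of positive forms given
by `S`. -/
def cell (h : Fin m → Fin n → Vec n →ᵃ[ℝ] ℝ) (S : Fin n → Finset (Fin m)) : Set (Vec n) :=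
  {x | ∀ i j, (i ∈ S j → 0 < h i j x) ∧ (i ∉ S j → h i j x < 0)}

variable {h : Fin m → Fin n → Vec n →ᵃ[ℝ] ℝ} {S : Fin n → Finset (Fin m)}

theorem convex_cell : Convex ℝ (cell h S) := by
  have : cell h S = ⋂ i, ⋂ j, {x | (i ∈ S j → 0 < h i j x) ∧ (i ∉ S j → h i j x < 0)} := by
    ext x; simp [cell]
  rw [this]
  refine convex_iInter fun i => convex_iInter fun j => ?_
  by_cases hi : i ∈ S j
  · simp only [hi, not_true_eq_false, forall_const, IsEmpty.forall_iff, and_true]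
    exact (convex_Ioi (0 : ℝ)).affine_preimage (h i j)
  · simp only [hi, not_false_eq_true, forall_const, IsEmpty.forall_iff, true_and]
    exact (convex_Iio (0 : ℝ)).affine_preimage (h i j)

theorem isOpen_cell : IsOpen (cell h S) := by
  have : cell h S = ⋂ i, ⋂ j, {x | (i ∈ S j → 0 < h i j x) ∧ (i ∉ S j → h i j x < 0)} := by
    ext x; simp [cell]
  rw [this]
  refine isOpen_iInter_of_finite fun i => isOpen_iInter_of_finite fun j => ?_
  have hc : Continuous (h i j) := (h i j).continuous_of_finiteDimensional
  by_cases hi : i ∈ S j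
  · simpa [hi] using isOpen_lt continuous_const hc
  · simpa [hi] using isOpen_lt hc continuous_const

theorem permVec_mem_cell (hh : IsEquivariant h) (σ : Equiv.Perm (Fin n)) {x : Vec n}
    (hx : x ∈ cell h S) : permVec σ x ∈ cell h (σ • S) := fun i j => by
  rw [hh i j σ x, perm_smul_apply]
  exact hx i (σ⁻¹ j)

theorem dense_ne_zero {g : Vec n →ᵃ[ℝ] ℝ} (hg : g ≠ 0) : Dense {x | g x ≠ 0} := by
  refine interior_eq_empty_iff_dense_compl.1 ?_ |>.mono (fun x hx => hx : {x | g x = 0}ᶜ ⊆ _)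
  by_contra hne
  refine hg (AffineMap.ext_on (isOpen_interior.affineSpan_eq_top
    (Set.nonempty_iff_ne_empty.2 hne)) fun x hx => ?_)
  simpa using interior_subset hx

/-- Every nonempty open set meets a cell, when no form vanishes identically. -/
theorem exists_mem_cell (hne : ∀ i j, h i j ≠ 0) {D : Set (Vec n)} (hD : IsOpen D)
    (hD' : D.Nonempty) : ∃ x ∈ D, ∃ S, x ∈ cell h S := by
  have hdense : Dense (⋂ p : Fin m × Fin n, {x | h p.1 p.2 x ≠ 0}) :=
    dense_iInter_of_isOpen
      (fun p => isOpen_ne_fun (h p.1 p.2).continuous_of_finiteDimensional continuous_const)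
      fun p => dense_ne_zero (hne p.1 p.2)
  obtain ⟨x, hxD, hx⟩ := hdense.inter_open_nonempty D hD hD'
  rw [Set.mem_iInter] at hx
  refine ⟨x, hxD, fun j => Finset.univ.filter fun i => 0 < h i j x, fun i j => ⟨?_, ?_⟩⟩
  · simp
  · intro hi
    simp only [Finset.mem_filter, Finset.mem_univ, true_and, not_lt] at hi
    exact lt_of_le_of_ne hi (hx (i, j))

/-- The mean of a point over a cyclic group of permutations is constant on the cycles and stays in
an invariant cell. -/
theorem exists_invariant_mem_cell (hh : IsEquivariant h) {g : Equiv.Perm (Fin n)} (hg : g • S = S)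
    (hS : (cell h S).Nonempty) : ∃ x ∈ cell h S, ∀ a, x (g a) = x a := by
  classical
  obtain ⟨x, hx⟩ := hS
  let Z := Subgroup.zpowers g
  have hZ : ∀ z : Z, (z : Equiv.Perm (Fin n)) • S = S := by
    intro z
    have : Z ≤ MulAction.stabilizer (Equiv.Perm (Fin n)) S := by
      rw [Subgroup.zpowers_le]; exact hg
    exact this z.2
  refine ⟨∑ z : Z, (Fintype.card Z : ℝ)⁻¹ • permVec (z : Equiv.Perm (Fin n)) x, ?_, ?_⟩
  · refine convex_cell.sum_mem (fun _ _ => by positivity) ?_ fun z _ => ?_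
    · simp
    · have := permVec_mem_cell hh (z : Equiv.Perm (Fin n)) hx
      rwa [hZ z] at this
  · intro a
    simp only [WithLp.ofLp_sum, WithLp.ofLp_smul, Finset.sum_apply, Pi.smul_apply, permVec_apply]
    let gZ : Z := ⟨g, Subgroup.mem_zpowers g⟩
    -- Evaluating at `g a` only reindexes the mean by `z ↦ g⁻¹ z`.
    refine Fintype.sum_equiv (Equiv.mulLeft gZ⁻¹) _ _ fun z => ?_
    simp [gZ]

/-- The sign patterns of the cells of the arrangement. -/
def patterns (hh : IsEquivariant h) :
    SubMulAction (Equiv.Perm (Fin n)) (Fin n → Finset (Fin m)) where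
  carrier := {S | (cell h S).Nonempty}
  smul_mem' σ _ := fun ⟨x, hx⟩ => ⟨permVec σ x, permVec_mem_cell hh σ hx⟩

/-- The cells stable by `g` correspond to cells of an arrangement in the space of the vectors fixed
by `g`. -/
theorem card_fixedBy_patterns_le (hh : IsEquivariant h) (g : Equiv.Perm (Fin n)) :
    Nat.card (MulAction.fixedBy (patterns hh) g) ≤
      ∑ k ∈ Finset.range (numCycles g + 1), (m * numCycles g).choose k := by
  classical
  let O := Quotient (Equiv.Perm.SameCycle.setoid g)
  have : Fintype O := Fintype.ofFinite _
  have hO : Fintype.card O = numCycles g := by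
    rw [numCycles, Nat.card_eq_fintype_card]
  let L : (O → ℝ) →ₗ[ℝ] Vec n :=
    (WithLp.linearEquiv 2 ℝ (Fin n → ℝ)).symm.toLinearMap ∘ₗ
      LinearMap.funLeft ℝ ℝ (fun a : Fin n => (⟦a⟧ : O))
  -- One representative `j` per cycle suffices: a pattern fixed by `g` is constant along cycles,
  -- which also makes `Φ` injective.
  let h' : O × Fin m → (O → ℝ) →ᵃ[ℝ] ℝ := fun p => (h p.2 p.1.out).comp L.toAffineMap
  let Φ : MulAction.fixedBy (patterns hh) g → Finset (O × Fin m) := fun S =>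
    Finset.univ.filter fun p => p.2 ∈ S.1.1 p.1.out
  have hfix : ∀ S : MulAction.fixedBy (patterns hh) g, g • S.1.1 = S.1.1 := fun S =>
    congrArg Subtype.val (show g • S.1 = S.1 from S.2)
  have hΦ : Function.Injective Φ := by
    intro S T hST
    refine Subtype.ext (Subtype.ext (funext fun a => ?_))
    have hrep : g.SameCycle a (⟦a⟧ : O).out :=
      (Quotient.mk_out (s := Equiv.Perm.SameCycle.setoid g) a).symm
    rw [eq_of_sameCycle ((perm_smul_eq_iff g _).1 (hfix S)) hrep,
      eq_of_sameCycle ((perm_smul_eq_iff g _).1 (hfix T)) hrep]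
    ext i
    have := congrArg (fun A => ((⟦a⟧ : O), i) ∈ A) hST
    simpa [Φ] using this
  have hcard := card_sign_patterns_le h' (Finset.univ.image Φ) (by
    intro A hA
    obtain ⟨S, -, rfl⟩ := Finset.mem_image.1 hA
    obtain ⟨x, hx, hxg⟩ := exists_invariant_mem_cell hh (hfix S) S.1.2
    have hL : L (fun o => x o.out) = x := by
      ext a
      exact (eq_of_sameCycle hxg
        (Quotient.mk_out (s := Equiv.Perm.SameCycle.setoid g) a))
    refine ⟨fun o => x o.out, fun p => ?_⟩
    have := hx p.2 p.1.out
    simpa [Φ, h', hL] using this)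
  rw [Finset.card_image_of_injective _ hΦ, Finset.card_univ, ← Nat.card_eq_fintype_card,
    Module.finrank_fintype_fun_eq_card, Fintype.card_prod, Fintype.card_fin, hO, mul_comm] at hcard
  exact hcard

theorem card_orbits_patterns_le (hm : 1 ≤ m) (hh : IsEquivariant h) :
    (Nat.card (Quotient (MulAction.orbitRel (Equiv.Perm (Fin n)) (patterns hh))) : ℝ) ≤
      orbitBound m n := by
  rw [orbitBound_eq, le_div_iff₀ (by positivity), ← sum_pow_numCycles]
  have hb := sum_natCard_fixedBy n (patterns hh)
  calc _ = ∑ g : Equiv.Perm (Fin n), (Nat.card (MulAction.fixedBy (patterns hh) g) : ℝ) := by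
        exact_mod_cast hb.symm
    _ ≤ _ := Finset.sum_le_sum fun g _ => by
        refine le_trans ?_ (sum_choose_le_alpha_add_one_pow hm (numCycles g))
        exact_mod_cast card_fixedBy_patterns_le hh g

end Arrangement

/-! ### From orbits of cells to classes of linear functions of a network. -/

section Networks

variable {m n q : ℕ} {K : Set (Vec n)} {f : K → Vec q}

/-- `f` is linear on the cells of the arrangement `h` and invariant by permutations. -/
structure IsAdapted (f : K → Vec q) (h : Fin m → Fin n → Vec n →ᵃ[ℝ] ℝ) : Prop where
  equivariant : IsEquivariant h
  ne_zero : ∀ i j, h i j ≠ 0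
  invariant : ∀ (σ : Equiv.Perm (Fin n)) (x y : K), (y : Vec n) = permVec σ x → f y = f x
  linear : ∀ S, IsLinearOn f (cell h S)

theorem IsRegion.image_permVec (hK : IsPermStable K) {D : Set (Vec n)} (hD : IsRegion K D)
    (σ : Equiv.Perm (Fin n)) : IsRegion K (permVec σ '' D) := by
  have e : permVec σ '' D = permIsometry σ '' D :=
    Set.image_congr fun x _ => (permIsometry_apply σ x).symm
  refine ⟨?_, ?_, ?_⟩
  · rw [e]
    exact (permIsometry σ).toHomeomorph.isOpenMap _ hD.1
  · rw [e]
    exact hD.2.1.image _ (permIsometry σ).continuous.continuousOn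
  · rintro _ ⟨x, hx, rfl⟩
    exact hK σ x (hD.2.2 hx)

theorem IsLinearOn.image_permVec {h : Fin m → Fin n → Vec n →ᵃ[ℝ] ℝ} (hf : IsAdapted f h)
    {D : Set (Vec n)} (hDK : D ⊆ K) (hD : IsLinearOn f D) (σ : Equiv.Perm (Fin n)) :
    IsLinearOn f (permVec σ '' D) := by
  obtain ⟨g, hg⟩ := hD
  refine ⟨g.comp (permIsometry σ⁻¹).toLinearEquiv.toLinearMap.toAffineMap, ?_⟩
  rintro y ⟨x, hx, hxy⟩
  rw [hf.invariant σ ⟨x, hDK hx⟩ y hxy.symm, hg ⟨x, hDK hx⟩ hx]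
  change g x = g (permIsometry σ⁻¹ y)
  rw [permIsometry_apply, ← hxy, permVec_inv_permVec]

/-- The part of the cell of `S'` in `interior K` is convex, hence a region on which `f` is linear.
It meets `D'` at `x'`, so `D'` absorbs it together with `permVec σ x`; then `D'` meets the image of
`D` and absorbs that too. -/
theorem image_permVec_subset {h : Fin m → Fin n → Vec n →ᵃ[ℝ] ℝ} (hf : IsAdapted f h)
    (hconv : Convex ℝ K) (hK : IsPermStable K) {D D' : Set (Vec n)} (hD : IsLinearRegion f D)
    (hD' : IsLinearRegion f D') {S S' : Fin n → Finset (Fin m)} {x x' : Vec n} (hx : x ∈ D)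
    (hxS : x ∈ cell h S) (hx' : x' ∈ D') (hxS' : x' ∈ cell h S') {σ : Equiv.Perm (Fin n)}
    (hσ : σ • S = S') : permVec σ '' D ⊆ D' := by
  have hσD := hD.1.image_permVec hK σ
  have hint : ∀ {U : Set (Vec n)}, IsRegion K U → U ⊆ interior K := fun hU =>
    interior_maximal hU.2.2 hU.1
  have hσx : permVec σ x ∈ cell h S' := hσ ▸ permVec_mem_cell hf.equivariant σ hxS
  have hW : IsRegion K (cell h S' ∩ interior K) :=
    ⟨isOpen_cell.inter isOpen_interior,
      ⟨⟨x', hxS', hint hD'.1 hx'⟩, (convex_cell.inter hconv.interior).isPreconnected⟩,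
      fun _ hy => interior_subset hy.2⟩
  have hWlin : IsLinearOn f (cell h S' ∩ interior K) := by
    obtain ⟨g, hg⟩ := hf.linear S'
    exact ⟨g, fun y hy => hg y hy.1⟩
  have hWD := hD'.subset_of_meets hW hWlin ⟨x', hx', hxS', hint hD'.1 hx'⟩
  refine hD'.subset_of_meets hσD (hD.2.1.image_permVec hf hD.1.2.2 σ) ⟨permVec σ x, ?_, x, hx, rfl⟩
  exact hWD ⟨hσx, hint hσD ⟨x, hx, rfl⟩⟩

/-- There are at most as many classes of linear functions as orbits of cells. -/
theorem complexity_le_card_orbits {h : Fin m → Fin n → Vec n →ᵃ[ℝ] ℝ} (hf : IsAdapted f h)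
    (hconv : Convex ℝ K) (hK : IsPermStable K) :
    complexity f ≤
      Nat.card (Quotient (MulAction.orbitRel (Equiv.Perm (Fin n)) (patterns hf.equivariant))) := by
  have hpt : ∀ D : LinearFunctions f, ∃ S : patterns hf.equivariant, ∃ x ∈ D.1, x ∈ cell h S.1 := by
    intro D
    obtain ⟨x, hx, S, hS⟩ := exists_mem_cell hf.ne_zero D.2.1.1 D.2.1.2.1.nonempty
    exact ⟨⟨S, x, hS⟩, x, hx, hS⟩
  choose P x hxD hxP using hpt
  have : Finite (Quotient (MulAction.orbitRel (Equiv.Perm (Fin n)) (patterns hf.equivariant))) :=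
    inferInstance
  rw [complexity, ← ENat.card_eq_coe_natCard]
  -- If the chosen patterns share an orbit, the inclusions for `σ` and `σ⁻¹` make `σ` carry one
  -- region onto the other.
  refine ENat.card_le_card_of_injective (f := fun c => ⟦P c.out⟧) fun c d hcd => ?_
  rw [← Quotient.out_eq c, ← Quotient.out_eq d]
  obtain ⟨σ, hσ⟩ := Quotient.exact hcd.symm
  have hσ1 : σ • (P c.out).1 = (P d.out).1 := congrArg Subtype.val hσ
  have hσ2 : σ⁻¹ • (P d.out).1 = (P c.out).1 := by rw [← hσ1, inv_smul_smul]
  have h1 := image_permVec_subset hf hconv hK c.out.2 d.out.2 (hxD _) (hxP _) (hxD _) (hxP _) hσ1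
  have h2 := image_permVec_subset hf hconv hK d.out.2 c.out.2 (hxD _) (hxP _) (hxD _) (hxP _) hσ2
  refine Quotient.sound ⟨(permIsometry σ).toAffineIsometryEquiv, ?_, ?_⟩
  · have e : ((permIsometry σ).toAffineIsometryEquiv : Vec n → Vec n) = permVec σ :=
      funext (permIsometry_apply σ)
    rw [e]
    refine h1.antisymm fun y hy => ⟨permVec σ⁻¹ y, h2 ⟨y, hy, rfl⟩, permVec_permVec_inv σ y⟩
  · intro y z _ hyz
    exact (hf.invariant σ y z (hyz.trans (permIsometry_apply σ y))).symm

/-- An affine map into `(ℝⁿ)^m` from its components. -/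
noncomputable def ofForms (h : Fin m → Fin n → Vec n →ᵃ[ℝ] ℝ) : Vec n →ᵃ[ℝ] (Fin m → Vec n) :=
  AffineMap.pi fun i => (WithLp.linearEquiv 2 ℝ (Fin n → ℝ)).symm.toLinearMap.toAffineMap.comp
    (AffineMap.pi (h i))

theorem ofForms_apply (h : Fin m → Fin n → Vec n →ᵃ[ℝ] ℝ) (x : Vec n) (i : Fin m) (j : Fin n) :
    ofForms h x i j = h i j x := rfl

/-- The `(i, j)` component of an affine map into `(ℝⁿ)^m`. -/
noncomputable def component (f₁ : Vec n →ᵃ[ℝ] (Fin m → Vec n)) (i : Fin m) (j : Fin n) :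
    Vec n →ᵃ[ℝ] ℝ :=
  ((EuclideanSpace.proj j : Vec n →L[ℝ] ℝ).toLinearMap ∘ₗ
    (LinearMap.proj i : (Fin m → Vec n) →ₗ[ℝ] Vec n)).toAffineMap.comp f₁

theorem component_apply (f₁ : Vec n →ᵃ[ℝ] (Fin m → Vec n)) (i : Fin m) (j : Fin n) (x : Vec n) :
    component f₁ i j x = f₁ x i j := rfl

open Classical in
/-- The components of `f₁`, those that vanish identically being replaced by `-1`, which has the
same positive part. -/
noncomputable def nonzeroComponent (f₁ : Vec n →ᵃ[ℝ] (Fin m → Vec n)) (i : Fin m) (j : Fin n) :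
    Vec n →ᵃ[ℝ] ℝ :=
  if component f₁ i j = 0 then AffineMap.const ℝ (Vec n) (-1) else component f₁ i j

theorem nonzeroComponent_ne_zero (f₁ : Vec n →ᵃ[ℝ] (Fin m → Vec n)) (i : Fin m) (j : Fin n) :
    nonzeroComponent f₁ i j ≠ 0 := by
  unfold nonzeroComponent
  split_ifs with h0
  · intro h
    have := congrArg (fun g : Vec n →ᵃ[ℝ] ℝ => g 0) h
    simp at this
  · exact h0

theorem max_nonzeroComponent (f₁ : Vec n →ᵃ[ℝ] (Fin m → Vec n)) (i : Fin m) (j : Fin n)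
    (x : Vec n) : max 0 (nonzeroComponent f₁ i j x) = max 0 (f₁ x i j) := by
  rw [← component_apply f₁ i j x]
  unfold nonzeroComponent
  split_ifs with h0
  · simp [h0]
  · rfl

theorem isEquivariant_nonzeroComponent {f₁ : Vec n →ᵃ[ℝ] (Fin m → Vec n)}
    (h₁ : ∀ (σ : Equiv.Perm (Fin n)) (x : Vec n), f₁ (permVec σ x) = permTuple σ (f₁ x)) :
    IsEquivariant (nonzeroComponent f₁) := by
  intro i j σ x
  have hc : ∀ x, component f₁ i j (permVec σ x) = component f₁ i (σ⁻¹ j) x := fun x => by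
    rw [component_apply, h₁]; rfl
  -- Vanishing is invariant under `S_n`, so the replacement by `-1` keeps equivariance.
  have hiff : component f₁ i j = 0 ↔ component f₁ i (σ⁻¹ j) = 0 := by
    constructor
    · intro h0
      ext x
      rw [← hc, h0]; rfl
    · intro h0
      ext x
      rw [← permVec_permVec_inv σ x, hc, h0]; rfl
  unfold nonzeroComponent
  by_cases h0 : component f₁ i j = 0
  · rw [if_pos h0, if_pos (hiff.1 h0)]; rfl
  · rw [if_neg h0, if_neg (mt hiff.2 h0)]; exact hc x

theorem relu_permTuple (σ : Equiv.Perm (Fin n)) (X : Fin m → Vec n) :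
    relu (permTuple σ X) = permTuple σ (relu X) := rfl

theorem exists_isAdapted {F : K → Vec q} (hF : F ∈ invNetworks K m q) :
    ∃ h : Fin m → Fin n → Vec n →ᵃ[ℝ] ℝ, IsAdapted F h := by
  classical
  obtain ⟨f₁, f₂, h₁, h₂, hF⟩ := hF
  refine ⟨nonzeroComponent f₁, isEquivariant_nonzeroComponent h₁, nonzeroComponent_ne_zero f₁,
    ?_, fun S => ?_⟩
  · intro σ x y hxy
    rw [hF, hF, hxy, h₁, relu_permTuple, h₂]
  -- On the cell of `S`, ReLU keeps the forms in `S` and kills the others.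
  · refine ⟨f₂.comp (ofForms fun i j => if i ∈ S j then nonzeroComponent f₁ i j else 0), ?_⟩
    intro x hx
    rw [hF, AffineMap.comp_apply]
    congr 1
    ext i j
    rw [ofForms_apply]
    change max 0 (f₁ x i j) = _
    rw [← max_nonzeroComponent]
    split_ifs with hi
    · exact max_eq_right ((hx i j).1 hi).le
    · exact max_eq_left ((hx i j).2 hi).le

theorem classComplexity_invNetworks_le (hm : 1 ≤ m) (hconv : Convex ℝ K) (hK : IsPermStable K) :
    classComplexity (invNetworks K m q) ≤ (⌊orbitBound m n⌋₊ : ℕ∞) := by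
  refine iSup₂_le fun F hF => ?_
  obtain ⟨h, hh⟩ := exists_isAdapted hF
  refine (complexity_le_card_orbits hh hconv hK).trans ?_
  exact_mod_cast Nat.le_floor (card_orbits_patterns_le hm hh.equivariant)

end Networks

end DeepSets

theorem mainTheorem2 (m : ℕ) (hm : 1 ≤ m) :
    (∀ (n q : ℕ) (K : Set (DeepSets.Vec n)),
      IsCompact K → Convex ℝ K → (interior K).Nonempty → DeepSets.IsPermStable K →
        (DeepSets.classComplexity (DeepSets.invNetworks K m q) : ENNReal) ≤
          ENNReal.ofReal (DeepSets.orbitBound m n)) ∧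
    ∃ p : Polynomial ℝ, p.natDegree = ⌊DeepSets.alpha m⌋₊ + 1 ∧
      ∀ n : ℕ, DeepSets.orbitBound m n ≤ p.eval (n : ℝ) := by
  refine ⟨fun n q K _ hconv _ hK => ?_, DeepSets.exists_polynomial_bound m⟩
  have hpos : 0 ≤ DeepSets.orbitBound m n :=
    div_nonneg (DeepSets.genFactorial_pos _).le
      (mul_nonneg (DeepSets.genFactorial_pos _).le (Nat.cast_nonneg _))
  calc (DeepSets.classComplexity (DeepSets.invNetworks K m q) : ENNReal)
      ≤ ((⌊DeepSets.orbitBound m n⌋₊ : ℕ∞) : ENNReal) :=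
        ENat.toENNReal_le.2 (DeepSets.classComplexity_invNetworks_le hm hconv hK)
    _ = ENNReal.ofReal (⌊DeepSets.orbitBound m n⌋₊ : ℝ) := by simp
    _ ≤ ENNReal.ofReal (DeepSets.orbitBound m n) :=
        ENNReal.ofReal_le_ofReal (Nat.floor_le hpos)
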